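/- Let $\sigma_X,\sigma_Y,\sigma_Z$ be the Pauli matrices and, for real $x,y,z$, let $$L(x,y,z)=\exp\bigl(i\,(x\,\sigma_X\otimes\sigma_X+y\,\sigma_Y\otimes\sigma_Y+z\,\sigma_Z\otimes\sigma_Z)\bigr).$$ Let the Weyl chamber be $$W=\{(x,y,z)\in\mathbb R^3:\ \tfrac{\pi}{4}\ge x\ge y\ge |z|,\ \text{and } z\ge 0 \text{ if } x=\tfrac{\pi}{4}\}.$$ A two-qubit gate $U\in SU(4)$ has interaction coefficients $\eta(U)=(x,y,z)\in W$ if $U=g\,(A_1\otimes A_2)\,L(x,y,z)\,(B_1\otimes B_2)$ for some $A_1,A_2,B_1,B_2\in SU(2)$ and $g\in\{1,i\}$. In the basis $|00\rangle,|01\rangle,|10\rangle,|11\rangle$, let $$\mathrm{SQiSW}=\begin{pmatrix}1&0&0&0\\0&\tfrac1{\sqrt2}&\tfrac{i}{\sqrt2}&0\\0&\tfrac{i}{\sqrt2}&\tfrac1{\sqrt2}&0\\0&0&0&1\end{pmatrix},$$ and let $S_2$ be the set of all gates $$(A_1\otimes A_2)\cdot\mathrm{SQiSW}\cdot(B_1\otimes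 B_2)\cdot\mathrm{SQiSW}\cdot(C_1\otimes C_2),\qquad A_j,B_j,C_j\in SU(2).$$ Then the set of points of the Weyl chamber that are reached by two SQiSW gates, $$W(S_2)=\{(x,y,z)\in W:\ (x,y,z)=\eta(U)\text{ for some }U\in S_2\},$$ is exactly $$W'=\{(x,y,z)\in W:\ \tfrac{\pi}{4}\ge x\ge y\ge |z|\ \text{ and }\ x\ge y+|z|\}.$$ -/

import Mathlib

open scoped Kronecker

namespace TwoQubit

noncomputable section

/-- Complex `4 × 4` matrices acting on two qubits. The basis vector `|ab⟩` is indexed by the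
pair `(a, b)`, so that the Kronecker product `A ⊗ₖ B` is `A` on the first qubit and `B` on the
second one. -/
abbrev Gate : Type := Matrix (Fin 2 × Fin 2) (Fin 2 × Fin 2) ℂ

/-- The Pauli matrix `σ_X`. -/
def pauliX : Matrix (Fin 2) (Fin 2) ℂ := !![0, 1; 1, 0]

/-- The Pauli matrix `σ_Y`. -/
def pauliY : Matrix (Fin 2) (Fin 2) ℂ := !![0, -Complex.I; Complex.I, 0]

/-- The Pauli matrix `σ_Z`. -/
def pauliZ : Matrix (Fin 2) (Fin 2) ℂ := !![1, 0; 0, -1]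

/-- The canonical gate `L(x, y, z) = exp (i (x XX + y YY + z ZZ))`. -/
def canonicalGate (x y z : ℝ) : Gate :=
  NormedSpace.exp (Complex.I • ((x : ℂ) • (pauliX ⊗ₖ pauliX) + (y : ℂ) • (pauliY ⊗ₖ pauliY)
    + (z : ℂ) • (pauliZ ⊗ₖ pauliZ)))

/-- The gate SQiSW, the square root of iSWAP, written in the basis `|00⟩, |01⟩, |10⟩, |11⟩`. -/
def SQiSW : Gate :=
  Matrix.reindex finProdFinEquiv.symm finProdFinEquiv.symm
    !![1, 0, 0, 0;
       0, 1 / (Real.sqrt 2 : ℂ), Complex.I / (Real.sqrt 2 : ℂ), 0;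
       0, Complex.I / (Real.sqrt 2 : ℂ), 1 / (Real.sqrt 2 : ℂ), 0;
       0, 0, 0, 1]

/-- The gates `A₁ ⊗ A₂` with `A₁, A₂ ∈ SU(2)`. -/
def localGates : Set Gate :=
  {U | ∃ A₁ ∈ Matrix.specialUnitaryGroup (Fin 2) ℂ,
    ∃ A₂ ∈ Matrix.specialUnitaryGroup (Fin 2) ℂ, U = A₁ ⊗ₖ A₂}

/-- The Weyl chamber `W`. -/
def weylChamber : Set (ℝ × ℝ × ℝ) :=
  {(x, y, z) | Real.pi / 4 ≥ x ∧ x ≥ y ∧ y ≥ |z| ∧ (x = Real.pi / 4 → 0 ≤ z)}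

/-- `η(U) = (x, y, z)`: the point `(x, y, z)` of the Weyl chamber is the triple of interaction
coefficients in a KAK decomposition `U = g (A₁ ⊗ A₂) L(x, y, z) (B₁ ⊗ B₂)` of `U`, with local
factors in `SU(2)` and a global phase `g ∈ {1, i}`. -/
def HasInteractionCoefficients (U : Gate) (η : ℝ × ℝ × ℝ) : Prop :=
  η ∈ weylChamber ∧ ∃ g : ℂ, (g = 1 ∨ g = Complex.I) ∧ ∃ A ∈ localGates, ∃ B ∈ localGates,
    U = g • (A * canonicalGate η.1 η.2.1 η.2.2 * B)

/-- The set `S₂` of the two-qubit gates given by circuits with two SQiSW gates and with arbitrary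
single-qubit rotations before, between and after them. -/
def twoSQiSWGates : Set Gate :=
  {U | ∃ A ∈ localGates, ∃ B ∈ localGates, ∃ C ∈ localGates, U = A * SQiSW * B * SQiSW * C}

/-- The subset `W(𝒢)` of the Weyl chamber spanned by a set `𝒢` of two-qubit gates. -/
def spannedRegion (𝒢 : Set Gate) : Set (ℝ × ℝ × ℝ) :=
  {η | ∃ U ∈ 𝒢, HasInteractionCoefficients U η}

/-- The region `W'` of the Weyl chamber. -/
def regionW' : Set (ℝ × ℝ × ℝ) :=
  {(x, y, z) | (x, y, z) ∈ weylChamber ∧ Real.pi / 4 ≥ x ∧ x ≥ y ∧ y ≥ |z| ∧ x ≥ y + |z|}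

end

end TwoQubit

/-!
For a gate `U` put `J = σ_Y ⊗ σ_Y` and `m(U) = U J Uᵀ J`. Local gates `A` satisfy `A J Aᵀ = J`,
so the characteristic polynomial of `m(U)` does not change when `U` is multiplied by local gates
on either side (`localInvariant_mul_mul`). The canonical gate `L(x, y, z)` is diagonal in the
magic basis with eigenvalues `exp (i λ)`, where the four phases `λ` are `x - y + z`, `x + y - z`,
`-x - y - z` and `-x + y + z`, and `m(L)` has the eigenvalues `exp (2 i λ)`.

The region is cut out by the value of this polynomial at `1`. For the canonical gate it is `16 ∏
sin λ`, whose sign in the Weyl chamber is that of `x - y - |z|`. For a circuit `SQiSW (B₁ ⊗ B₂)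
SQiSW`, where `B₁` and `B₂` have first rows `(p, q)` and `(r, s)`, the determinant factors and
the value is the square `4 (|q|² - |s|²)²` (`det_smul_iSWAPInv_mul_sub`). A global phase `i`
replaces `m` by `-m`, so that the value at `-1` is needed too; it is larger by a sum of squares
(`exists_nonneg_eval_localInvariant`). This proves one inclusion.

For the other one, gates with determinant `1` and the same polynomial as a canonical gate are
locally equivalent to it (`exists_local_of_localInvariant_eq`). In the magic basis `Uᵀ U` is a
symmetric unitary matrix, so a real orthogonal matrix diagonalizes it, and `U` becomes a product
`K D O` with `D` diagonal and `K`, `O` real orthogonal. By the Cartan–Dieudonné theorem real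
orthogonal matrices are products of reflections, and in the magic basis a reflection is SWAP
times a local gate (`magic_mul_reflection_mul`). It remains to solve for `B₁` and `B₂` whose
circuit has the prescribed polynomial, which `exists_parameters` does in closed form: `|q|²` and
`|s|²` are the roots of a quadratic equation whose discriminant is nonnegative exactly when `∏
sin λ` is.
-/

open Matrix Polynomial

/-! ### Diagonalization of symmetric unitary matrices by real orthogonal matrices -/

/-- Commuting symmetric operators on a finite-dimensional Euclidean space have a common
orthonormal eigenbasis. -/
theorem LinearMap.IsSymmetric.exists_orthonormalBasis_of_commute {E : Type*}
    [NormedAddCommGroup E] [InnerProductSpace ℝ E] [FiniteDimensional ℝ E] {A B : E →ₗ[ℝ] E}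
    (hA : A.IsSymmetric) (hB : B.IsSymmetric) (hAB : Commute A B) :
    ∃ (b : OrthonormalBasis (Fin (Module.finrank ℝ E)) ℝ E) (α β : Fin (Module.finrank ℝ E) → ℝ),
      ∀ j, A (b j) = α j • b j ∧ B (b j) = β j • b j := by
  classical
  have hI := LinearMap.IsSymmetric.directSum_isInternal_of_commute hA hB hAB
  have hO := LinearMap.IsSymmetric.orthogonalFamily_eigenspace_inf_eigenspace hA hB
  -- an orthonormal basis subordinate to a decomposition needs finitely many summands, so the
  -- zero ones are discarded
  have hfin := WellFoundedGT.finite_ne_bot_of_iSupIndep hI.submodule_iSupIndep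
  rw [← DirectSum.isInternal_ne_bot_iff] at hI
  have : Fintype {i : ℝ × ℝ //
      Module.End.eigenspace A i.2 ⊓ Module.End.eigenspace B i.1 ≠ ⊥} := hfin.fintype
  have hO' := hO.comp (Subtype.val_injective (p := fun i : ℝ × ℝ =>
    Module.End.eigenspace A i.2 ⊓ Module.End.eigenspace B i.1 ≠ ⊥))
  refine ⟨hI.subordinateOrthonormalBasis rfl hO',
    fun j => (hI.subordinateOrthonormalBasisIndex rfl j hO').1.2,
    fun j => (hI.subordinateOrthonormalBasisIndex rfl j hO').1.1, fun j => ?_⟩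
  have := hI.subordinateOrthonormalBasis_subordinate rfl j hO'
  exact ⟨Module.End.mem_eigenspace_iff.1 this.1, Module.End.mem_eigenspace_iff.1 this.2⟩

namespace Matrix

variable {ι : Type*} [Fintype ι] [DecidableEq ι]

theorem map_ofReal_mul_transpose {O : Matrix ι ι ℝ} (hO : O * Oᵀ = 1) :
    O.map Complex.ofReal * (O.map Complex.ofReal)ᵀ = 1 := by
  have h := congrArg (fun M : Matrix ι ι ℝ => M.map Complex.ofRealHom) hO
  rw [Matrix.map_mul, Matrix.map_one _ (map_zero _) (map_one _)] at h
  exact h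

/-- A symmetric unitary matrix is diagonalized by a real orthogonal matrix: its real and imaginary
parts are commuting real symmetric matrices. -/
theorem exists_orthogonal_diagonal_of_symm_unitary {N : Matrix ι ι ℂ} (hs : Nᵀ = N)
    (hu : N * Nᴴ = 1) :
    ∃ O : Matrix ι ι ℝ, O * Oᵀ = 1 ∧ ∃ d : ι → ℂ,
      N = O.map Complex.ofReal * diagonal d * (O.map Complex.ofReal)ᵀ := by
  have hs' : ∀ i j, N i j = N j i := fun i j => congrFun (congrFun hs j) i
  have hX : (toEuclideanLin (N.map Complex.re)).IsSymmetric := by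
    rw [isSymmetric_toEuclideanLin_iff]
    ext i j; simp [hs' i j]
  have hY : (toEuclideanLin (N.map Complex.im)).IsSymmetric := by
    rw [isSymmetric_toEuclideanLin_iff]
    ext i j; simp [hs' i j]
  have hXY : N.map Complex.re * N.map Complex.im = N.map Complex.im * N.map Complex.re := by
    ext i j
    have := congrArg Complex.im (congrFun (congrFun hu i) j)
    have h1 : ((1 : Matrix ι ι ℂ) i j).im = 0 := by
      by_cases h : i = j <;> simp [h, Matrix.one_apply]
    rw [h1, mul_apply, Complex.im_sum] at this
    simp only [conjTranspose_apply, Complex.mul_im, Complex.star_def, Complex.conj_re,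
      Complex.conj_im, Finset.sum_add_distrib] at this
    simp only [mul_apply, map_apply]
    have h2 : ∑ k, (N i k).re * -(N j k).im = -∑ k, (N i k).re * (N k j).im := by
      rw [← Finset.sum_neg_distrib]
      exact Finset.sum_congr rfl fun k _ => by rw [hs' j k]; ring
    have h3 : ∑ k, (N i k).im * (N j k).re = ∑ k, (N i k).im * (N k j).re :=
      Finset.sum_congr rfl fun k _ => by rw [hs' j k]
    rw [h2, h3] at this
    linarith
  have hc : Commute (toEuclideanLin (N.map Complex.re)) (toEuclideanLin (N.map Complex.im)) := by
    refine LinearMap.ext fun v => ?_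
    apply (WithLp.ofLp_injective 2)
    simp [hXY]
  obtain ⟨b', α', β', hb'⟩ := hX.exists_orthonormalBasis_of_commute hY hc
  let e : Fin (Module.finrank ℝ (EuclideanSpace ℝ ι)) ≃ ι :=
    (finCongr finrank_euclideanSpace).trans (Fintype.equivFin ι).symm
  let b := b'.reindex e
  let O : Matrix ι ι ℝ := Matrix.of fun i j => b j i
  have hO : Oᵀ * O = 1 := by
    ext i j
    have := orthonormal_iff_ite.1 b.orthonormal i j
    rw [PiLp.inner_apply] at this
    simp only [RCLike.inner_apply, conj_trivial] at this
    rw [one_apply, ← this, mul_apply]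
    exact Finset.sum_congr rfl fun k _ => mul_comm _ _
  have hO' := map_ofReal_mul_transpose (mul_eq_one_comm.1 hO)
  refine ⟨O, mul_eq_one_comm.1 hO, fun j => α' (e.symm j) + β' (e.symm j) * Complex.I, ?_⟩
  have key : N * O.map Complex.ofReal = O.map Complex.ofReal *
      diagonal fun j => (α' (e.symm j) + β' (e.symm j) * Complex.I : ℂ) := by
    ext i j
    obtain ⟨h1, h2⟩ := hb' (e.symm j)
    have h1 := congrArg (fun v : EuclideanSpace ℝ ι => v i) h1
    have h2 := congrArg (fun v : EuclideanSpace ℝ ι => v i) h2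
    simp [mulVec, dotProduct] at h1 h2
    rw [mul_diagonal, mul_apply]
    apply Complex.ext
    · simp [O, b, h1, mul_comm]
    · simp [O, b, h2, mul_comm]
  rw [← key, Matrix.mul_assoc, hO', Matrix.mul_one]

/-- The diagonalization of a symmetric unitary matrix by a real orthogonal one, with the
eigenvalues in a prescribed order. -/
theorem exists_orthogonal_diagonal_of_charpoly {N : Matrix ι ι ℂ} (hs : Nᵀ = N)
    (hu : N * Nᴴ = 1) {μ : ι → ℂ} (hμ : N.charpoly = ∏ i, (X - C (μ i))) :
    ∃ O : Matrix ι ι ℝ, O * Oᵀ = 1 ∧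
      N = O.map Complex.ofReal * diagonal μ * (O.map Complex.ofReal)ᵀ := by
  obtain ⟨O, hO, d, hN⟩ := exists_orthogonal_diagonal_of_symm_unitary hs hu
  have h1 := map_ofReal_mul_transpose hO
  have h2 : N.charpoly = ∏ i, (X - C (d i)) := by
    rw [hN, Matrix.mul_assoc, charpoly_mul_comm, Matrix.mul_assoc, mul_eq_one_comm.1 h1,
      Matrix.mul_one, charpoly_diagonal]
  have h3 : Finset.univ.val.map d = Finset.univ.val.map μ := by
    have := congrArg roots (h2.symm.trans hμ)
    rw [roots_prod _ _ (Finset.prod_ne_zero_iff.2 fun i _ => X_sub_C_ne_zero _),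
      roots_prod _ _ (Finset.prod_ne_zero_iff.2 fun i _ => X_sub_C_ne_zero _)] at this
    simpa only [roots_X_sub_C, Multiset.bind_singleton] using this
  obtain ⟨σ, hσ⟩ : ∃ σ : Equiv.Perm ι, ∀ i, μ (σ i) = d i := by
    have h4 : ∀ c, Nonempty ({i // d i = c} ≃ {i // μ i = c}) := fun c => by
      have := congrArg (Multiset.count c) h3
      rw [Multiset.count_map, Multiset.count_map] at this
      rw [← Fintype.card_eq, Fintype.card_subtype, Fintype.card_subtype]
      simpa [Finset.card, Finset.filter, eq_comm] using this
    exact ⟨Equiv.ofFiberEquiv fun c => (h4 c).some, fun i => Equiv.ofFiberEquiv_map _ i⟩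
  refine ⟨O.submatrix id σ.symm, ?_, ?_⟩
  · rw [transpose_submatrix, submatrix_mul_equiv, hO, submatrix_id_id]
  · rw [hN]
    ext i j
    rw [mul_apply, mul_apply]
    simp only [mul_diagonal]
    refine (Finset.sum_congr rfl fun k _ => ?_).trans (Equiv.sum_comp σ _)
    simp [hσ]

/-- Two-sided real orthogonal diagonalization of a unitary matrix `U`, the eigenvalues of `Uᵀ U`
being the squares of the diagonal entries. -/
theorem exists_orthogonal_mul_diagonal_mul_orthogonal {U : Matrix ι ι ℂ} (hU : U ∈ unitaryGroup ι ℂ)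
    {μ : ι → ℂ} (hμ : ∀ i, μ i * star (μ i) = 1)
    (hc : (Uᵀ * U).charpoly = ∏ i, (X - C (μ i ^ 2))) :
    ∃ K : Matrix ι ι ℝ, K * Kᵀ = 1 ∧ ∃ O : Matrix ι ι ℝ, O * Oᵀ = 1 ∧
      U = K.map Complex.ofReal * diagonal μ * O.map Complex.ofReal := by
  have hU1 : U * Uᴴ = 1 := mem_unitaryGroup_iff.1 hU
  have hU2 : Uᵀ * (Uᵀ)ᴴ = 1 := by
    have := congrArg transpose (mul_eq_one_comm.1 hU1)
    rwa [transpose_mul, transpose_one, ← conjTranspose_transpose_eq_transpose_conjTranspose] at this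
  obtain ⟨R, hR, hN⟩ := exists_orthogonal_diagonal_of_charpoly (N := Uᵀ * U)
    (by simp) (by
      rw [conjTranspose_mul, Matrix.mul_assoc, ← Matrix.mul_assoc U, hU1, Matrix.one_mul, hU2]) hc
  have hR1 := map_ofReal_mul_transpose hR
  have hR2 := mul_eq_one_comm.1 hR1
  set R' := R.map Complex.ofReal with hR'
  have hRs : R'ᴴ = R'ᵀ := by ext i j; simp [hR']
  have hD : diagonal μ * diagonal (star μ) = 1 := by
    rw [diagonal_mul_diagonal, ← diagonal_one]; congr 1; ext i; exact hμ i
  have hD2 : diagonal (star μ) * diagonal μ = 1 := mul_eq_one_comm.1 hD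
  have hDs : diagonal (fun i => μ i ^ 2) = diagonal μ * diagonal μ := by
    rw [diagonal_mul_diagonal]; congr 1; ext i; ring
  -- `K = U R D⁻¹` is unitary, and complex orthogonal by the choice of `R`; hence it is real.
  set K := U * R' * diagonal (star μ) with hK
  have hKu : K * Kᴴ = 1 := by
    rw [hK, conjTranspose_mul, conjTranspose_mul, diagonal_conjTranspose, star_star, hRs]
    calc U * R' * diagonal (star μ) * (diagonal μ * (R'ᵀ * Uᴴ))
        = U * (R' * (diagonal (star μ) * diagonal μ) * R'ᵀ) * Uᴴ := by
          simp only [Matrix.mul_assoc]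
      _ = 1 := by rw [hD2, Matrix.mul_one, hR1, Matrix.mul_one, hU1]
  have hKo : Kᵀ * K = 1 := by
    rw [hK, transpose_mul, transpose_mul, diagonal_transpose]
    calc diagonal (star μ) * (R'ᵀ * Uᵀ) * (U * R' * diagonal (star μ))
        = diagonal (star μ) * (R'ᵀ * (Uᵀ * U) * R') * diagonal (star μ) := by
          simp only [Matrix.mul_assoc]
      _ = diagonal (star μ) * ((R'ᵀ * R') * diagonal (fun i => μ i ^ 2) * (R'ᵀ * R'))
            * diagonal (star μ) := by rw [hN]; simp only [Matrix.mul_assoc]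
      _ = (diagonal (star μ) * diagonal μ) * (diagonal μ * diagonal (star μ)) := by
          rw [hR2, Matrix.one_mul, Matrix.mul_one, hDs]; simp only [Matrix.mul_assoc]
      _ = 1 := by rw [hD, hD2, Matrix.one_mul]
  have hKr : Kᵀ = Kᴴ := by
    rw [← Matrix.mul_one Kᵀ, ← hKu, ← Matrix.mul_assoc, hKo, Matrix.one_mul]
  have hKm : (K.map Complex.re).map Complex.ofReal = K := by
    ext i j
    have h : K i j = star (K i j) := congrFun (congrFun hKr j) i
    exact (Complex.conj_eq_iff_re.1 h.symm)
  refine ⟨K.map Complex.re, ?_, Rᵀ, ?_, ?_⟩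
  · refine mul_eq_one_comm.1 ?_
    apply Matrix.map_injective Complex.ofRealHom.injective
    change ((K.map Complex.re)ᵀ * K.map Complex.re).map Complex.ofRealHom =
      (1 : Matrix ι ι ℝ).map Complex.ofRealHom
    rw [Matrix.map_mul, Matrix.map_one _ (map_zero _) (map_one _)]
    change ((K.map Complex.re).map Complex.ofReal)ᵀ * ((K.map Complex.re).map Complex.ofReal) = _
    rw [hKm, hKo]
  · rw [transpose_transpose, mul_eq_one_comm.1 hR]
  · rw [hKm, hK, transpose_map, ← hR']
    calc U = U * (R' * R'ᵀ) := by rw [hR1, Matrix.mul_one]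
      _ = U * R' * (diagonal (star μ) * diagonal μ) * R'ᵀ := by
        rw [hD2, Matrix.mul_one, Matrix.mul_assoc]
      _ = _ := by simp only [Matrix.mul_assoc]

end Matrix

/-! ### Local gates, SWAP and the magic basis -/

namespace TwoQubit

theorem mem_specialUnitaryGroup_of_mul_star {p q : ℂ} (h : p * star p + q * star q = 1) :
    !![p, q; -star q, star p] ∈ specialUnitaryGroup (Fin 2) ℂ := by
  rw [mem_specialUnitaryGroup_iff, mem_unitaryGroup_iff]
  refine ⟨?_, by rw [det_fin_two_of]; linear_combination h⟩
  rw [Complex.star_def] at h ⊢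
  ext i j
  fin_cases i <;> fin_cases j <;> simp [mul_apply, Fin.sum_univ_two, star_eq_conjTranspose]
  · exact h
  · ring
  · ring
  · linear_combination h

theorem mul_mem_localGates {A B : Gate} (hA : A ∈ localGates) (hB : B ∈ localGates) :
    A * B ∈ localGates := by
  obtain ⟨A₁, h1, A₂, h2, rfl⟩ := hA
  obtain ⟨B₁, h3, B₂, h4, rfl⟩ := hB
  exact ⟨A₁ * B₁, mul_mem h1 h3, A₂ * B₂, mul_mem h2 h4, mul_kronecker_mul A₁ B₁ A₂ B₂ |>.symm⟩

theorem one_mem_localGates : (1 : Gate) ∈ localGates :=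
  ⟨1, one_mem _, 1, one_mem _, one_kronecker_one.symm⟩

theorem det_of_mem_localGates {A : Gate} (hA : A ∈ localGates) : A.det = 1 := by
  obtain ⟨A₁, h1, A₂, h2, rfl⟩ := hA
  rw [det_kronecker, (mem_specialUnitaryGroup_iff.1 h1).2, (mem_specialUnitaryGroup_iff.1 h2).2]
  simp

theorem mem_unitaryGroup_of_mem_localGates {A : Gate} (hA : A ∈ localGates) :
    A ∈ unitaryGroup (Fin 2 × Fin 2) ℂ := by
  obtain ⟨A₁, h1, A₂, h2, rfl⟩ := hA
  exact kronecker_mem_unitary (mem_specialUnitaryGroup_iff.1 h1).1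
    (mem_specialUnitaryGroup_iff.1 h2).1

/-- The gate SWAP, exchanging the two qubits. -/
def swapGate : Gate := Matrix.of fun p q => if p = q.swap then 1 else 0

theorem mul_swapGate_apply (A : Gate) (p q : Fin 2 × Fin 2) :
    (A * swapGate) p q = A p q.swap := by
  simp [swapGate, mul_apply]

theorem swapGate_mul_apply (A : Gate) (p q : Fin 2 × Fin 2) :
    (swapGate * A) p q = A p.swap q := by
  have h : ∀ x : Fin 2 × Fin 2, (p = x.swap) = (x = p.swap) := fun x =>
    propext ⟨fun h => by rw [h, Prod.swap_swap], fun h => by rw [h, Prod.swap_swap]⟩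
  simp [swapGate, mul_apply, h]

theorem swapGate_mul_swapGate : swapGate * swapGate = 1 := by
  ext p q
  rw [mul_swapGate_apply, swapGate, of_apply, Prod.swap_swap, one_apply]

theorem swapGate_mul_kronecker (A B : Matrix (Fin 2) (Fin 2) ℂ) :
    swapGate * (A ⊗ₖ B) = (B ⊗ₖ A) * swapGate := by
  ext p q
  rw [mul_swapGate_apply, swapGate_mul_apply]
  simp [kroneckerMap_apply, mul_comm]

theorem det_swapGate : swapGate.det = -1 := by
  have h : (swapGate.submatrix finProdFinEquiv.symm finProdFinEquiv.symm).det = -1 := by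
    have : swapGate.submatrix finProdFinEquiv.symm finProdFinEquiv.symm =
        !![1, 0, 0, 0; 0, 0, 1, 0; 0, 1, 0, 0; 0, 0, 0, (1 : ℂ)] := by
      ext i j
      fin_cases i <;> fin_cases j <;> simp [swapGate] <;> decide
    rw [this]
    simp [det_succ_row_zero, Fin.sum_univ_succ, Fin.succAbove]
  rwa [det_submatrix_equiv_self] at h

/-- Local gates, possibly preceded by an exchange of the qubits. In the magic basis these form
the full orthogonal group `O(4)`. -/
def localSwapGates : Set Gate := {U | U ∈ localGates ∨ ∃ V ∈ localGates, U = V * swapGate}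

theorem mul_mem_localSwapGates {A B : Gate} (hA : A ∈ localSwapGates) (hB : B ∈ localSwapGates) :
    A * B ∈ localSwapGates := by
  have hs : ∀ V ∈ localGates, ∃ V' ∈ localGates, swapGate * V = V' * swapGate := by
    rintro _ ⟨V₁, h1, V₂, h2, rfl⟩
    exact ⟨_, ⟨V₂, h2, V₁, h1, rfl⟩, swapGate_mul_kronecker _ _⟩
  rcases hA with hA | ⟨A, hA, rfl⟩ <;> rcases hB with hB | ⟨B, hB, rfl⟩
  · exact Or.inl (mul_mem_localGates hA hB)
  · exact Or.inr ⟨_, mul_mem_localGates hA hB, (Matrix.mul_assoc _ _ _).symm⟩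
  · obtain ⟨B', hB', h⟩ := hs B hB
    exact Or.inr ⟨_, mul_mem_localGates hA hB', by
      rw [Matrix.mul_assoc, h, Matrix.mul_assoc]⟩
  · obtain ⟨B', hB', h⟩ := hs B hB
    refine Or.inl ?_
    have : A * swapGate * (B * swapGate) = A * B' := by
      rw [Matrix.mul_assoc, ← Matrix.mul_assoc swapGate, h, Matrix.mul_assoc B',
        swapGate_mul_swapGate, Matrix.mul_one]
    rw [this]
    exact mul_mem_localGates hA hB'

noncomputable section

/-- The magic basis: up to the factor `1 / √2`, its vectors are the columns of coefficients of the
quaternion units `1, i σ_X, i σ_Y, i σ_Z`. -/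
def magic : Gate :=
  Matrix.of fun p q => ((Real.sqrt 2 : ℝ) : ℂ)⁻¹ *
    (!![!![1, 0; 0, 1], Complex.I • pauliX; Complex.I • pauliY, Complex.I • pauliZ] :
      Matrix (Fin 2) (Fin 2) (Matrix (Fin 2) (Fin 2) ℂ)) q.1 q.2 p.1 p.2

end

theorem inv_sqrt_two_mul_self : ((Real.sqrt 2 : ℝ) : ℂ)⁻¹ * ((Real.sqrt 2 : ℝ) : ℂ)⁻¹ = 1 / 2 := by
  rw [← mul_inv, ← Complex.ofReal_mul, Real.mul_self_sqrt (by norm_num)]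
  norm_num

theorem magic_mul_conjTranspose : magic * magicᴴ = 1 := by
  have h := inv_sqrt_two_mul_self
  rw [← sq] at h
  ext ⟨a, b⟩ ⟨c, d⟩
  fin_cases a <;> fin_cases b <;> fin_cases c <;> fin_cases d <;>
  simp [magic, mul_apply, Fintype.sum_prod_type, Fin.sum_univ_two, pauliX, pauliY, pauliZ,
    one_apply] <;>
  ring_nf <;> simp only [Complex.I_sq, h] <;> norm_num

theorem magic_conjTranspose_mul : magicᴴ * magic = 1 := mul_eq_one_comm.1 magic_mul_conjTranspose

theorem magic_mul_transpose : magic * magicᵀ = -(pauliY ⊗ₖ pauliY) := by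
  have h := inv_sqrt_two_mul_self
  rw [← sq] at h
  ext ⟨a, b⟩ ⟨c, d⟩
  fin_cases a <;> fin_cases b <;> fin_cases c <;> fin_cases d <;>
  simp [magic, mul_apply, Fintype.sum_prod_type, Fin.sum_univ_two, pauliX, pauliY, pauliZ] <;>
  ring_nf <;> simp only [Complex.I_sq, h] <;> norm_num

/-- In the magic basis the reflection in the hyperplane orthogonal to a real unit vector is the
exchange of the qubits followed by a local gate `A ⊗ A⁻¹`. Here `A` is, up to a fixed factor, the
vector regarded as a unit quaternion. -/
theorem magic_mul_reflection_mul (u : Fin 2 × Fin 2 → ℝ) (hu : ∑ i, u i ^ 2 = 1) :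
    magic * (1 - (2 : ℝ) • vecMulVec u u : Matrix _ _ ℝ).map Complex.ofReal * magicᴴ ∈
      localSwapGates := by
  have h := inv_sqrt_two_mul_self
  set a : ℂ := u (0, 0) + u (1, 1) * Complex.I with ha
  set b : ℂ := u (1, 0) + u (0, 1) * Complex.I with hb
  have hsa : star a = u (0, 0) - u (1, 1) * Complex.I := by simp [ha, sub_eq_add_neg]
  have hsb : star b = u (1, 0) - u (0, 1) * Complex.I := by simp [hb, sub_eq_add_neg]
  have hab : a * star a + b * star b = 1 := by
    have : ((∑ i, u i ^ 2 : ℝ) : ℂ) = 1 := by rw [hu]; simp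
    simp only [Fintype.sum_prod_type, Fin.sum_univ_two, Complex.ofReal_add,
      Complex.ofReal_pow] at this
    rw [hsa, hsb, ha, hb]
    linear_combination this - (u (1,1) ^ 2 + u (0,1) ^ 2 : ℂ) * Complex.I_mul_I
  have hψ : magic *ᵥ (fun i => (u i : ℂ)) = fun p => ((Real.sqrt 2 : ℝ) : ℂ)⁻¹ *
      (!![a, b; -star b, star a] : Matrix (Fin 2) (Fin 2) ℂ) p.1 p.2 := by
    rw [hsa, hsb]
    ext ⟨i, j⟩
    fin_cases i <;> fin_cases j <;>
    simp [mulVec, dotProduct, Fintype.sum_prod_type, Fin.sum_univ_two, magic, pauliX, pauliY,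
      pauliZ, ha, hb] <;> ring
  have hmap : (1 - (2 : ℝ) • vecMulVec u u : Matrix _ _ ℝ).map Complex.ofReal =
      1 - (2 : ℂ) • vecMulVec (fun i => (u i : ℂ)) (fun i => (u i : ℂ)) := by
    ext i j
    by_cases hij : i = j <;> simp [vecMulVec, one_apply, hij]
  have hR : magic * (1 - (2 : ℝ) • vecMulVec u u : Matrix _ _ ℝ).map Complex.ofReal * magicᴴ =
      1 - (2 : ℂ) • vecMulVec (magic *ᵥ fun i => (u i : ℂ)) (star (magic *ᵥ fun i => (u i : ℂ))) := by
    have hstar : star (magic *ᵥ fun i => (u i : ℂ)) = (fun i => (u i : ℂ)) ᵥ* magicᴴ := by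
      rw [star_mulVec]
      congr 1
      ext i
      simp
    rw [hmap, hstar, Matrix.mul_sub, Matrix.sub_mul, Matrix.mul_one, magic_mul_conjTranspose,
      Matrix.mul_smul, Matrix.smul_mul, mul_vecMulVec, vecMulVec_mul]
  have h1 : b * star b + -a * star (-a) = 1 := by rw [star_neg]; linear_combination hab
  have h2 : star b * star (star b) + a * star a = 1 := by rw [star_star]; linear_combination hab
  have h' := h
  rw [← sq] at h'
  refine Or.inr ⟨_, ⟨_, mem_specialUnitaryGroup_of_mul_star h1, _,
    mem_specialUnitaryGroup_of_mul_star h2, rfl⟩, ?_⟩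
  rw [hR, hψ]
  clear_value a b
  clear hR hmap hψ hsa hsb
  simp only [Complex.star_def] at hab ⊢
  ext ⟨i, j⟩ ⟨k, l⟩
  rw [mul_swapGate_apply, Matrix.sub_apply, Matrix.smul_apply, vecMulVec_apply, smul_eq_mul]
  have hc : (starRingEnd ℂ) ((Real.sqrt 2 : ℝ) : ℂ) = ((Real.sqrt 2 : ℝ) : ℂ) :=
    Complex.conj_ofReal _
  fin_cases i <;> fin_cases j <;> fin_cases k <;> fin_cases l <;>
  simp [one_apply, kroneckerMap_apply, hc]
  all_goals ring_nf
  all_goals try simp only [h']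
  all_goals first | ring1 | linear_combination -hab

/-! ### Orthogonal matrices in the magic basis -/

theorem toEuclideanLin_reflection {ι : Type*} [Fintype ι] [DecidableEq ι]
    (v x : EuclideanSpace ℝ ι) (hv : v ≠ 0) :
    (ℝ ∙ v)ᗮ.reflection x =
      toEuclideanLin (1 - (2 : ℝ) • vecMulVec (‖v‖⁻¹ • v).ofLp (‖v‖⁻¹ • v).ofLp) x := by
  have hv' : ‖v‖ ≠ 0 := norm_ne_zero_iff.2 hv
  rw [Submodule.reflection_orthogonal_apply, Submodule.reflection_singleton_apply]
  apply WithLp.ofLp_injective 2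
  ext i
  simp [vecMulVec_mulVec, PiLp.inner_apply, dotProduct]
  simp_rw [mul_comm (v.ofLp _) (x.ofLp _)]
  field_simp

theorem magic_mul_mul_magic_mul (A B : Gate) :
    magic * (A * B) * magicᴴ = (magic * A * magicᴴ) * (magic * B * magicᴴ) := by
  calc _ = magic * A * 1 * B * magicᴴ := by simp only [Matrix.mul_assoc, Matrix.one_mul]
    _ = _ := by rw [← magic_conjTranspose_mul]; simp only [Matrix.mul_assoc]

theorem magic_mul_one_mul : magic * 1 * magicᴴ = 1 := by
  rw [Matrix.mul_one, magic_mul_conjTranspose]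

/-- Real orthogonal matrices are, in the magic basis, local gates up to an exchange of the qubits:
by the Cartan–Dieudonné theorem they are products of reflections. -/
theorem magic_mul_orthogonal_mul {O : Matrix (Fin 2 × Fin 2) (Fin 2 × Fin 2) ℝ}
    (hO : O * Oᵀ = 1) : magic * O.map Complex.ofReal * magicᴴ ∈ localSwapGates := by
  have key : ∀ (l : List (EuclideanSpace ℝ (Fin 2 × Fin 2)))
      (K : Matrix (Fin 2 × Fin 2) (Fin 2 × Fin 2) ℝ),
      (∀ x, (l.map fun v => (ℝ ∙ v)ᗮ.reflection).prod x = toEuclideanLin K x) →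
      magic * K.map Complex.ofReal * magicᴴ ∈ localSwapGates := by
    intro l
    induction l with
    | nil =>
      intro K hK
      have : K = 1 := by
        apply toEuclideanLin.injective
        ext1 x
        rw [← hK]; simp
      rw [this, Matrix.map_one _ Complex.ofReal_zero Complex.ofReal_one, magic_mul_one_mul]
      exact Or.inl one_mem_localGates
    | cons v l ih =>
      intro K hK
      by_cases hv : v = 0
      · refine ih K fun x => ?_
        rw [← hK, List.map_cons, List.prod_cons, LinearIsometryEquiv.coe_mul, Function.comp_apply,
          Submodule.reflection_mem_subspace_eq_self]
        simp [hv]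
      · set R : Matrix (Fin 2 × Fin 2) (Fin 2 × Fin 2) ℝ :=
          1 - (2 : ℝ) • vecMulVec (‖v‖⁻¹ • v).ofLp (‖v‖⁻¹ • v).ofLp with hR
        set K' := toEuclideanLin.symm
          ((l.map fun v => (ℝ ∙ v)ᗮ.reflection).prod.toLinearEquiv :
            EuclideanSpace ℝ (Fin 2 × Fin 2) →ₗ[ℝ] EuclideanSpace ℝ (Fin 2 × Fin 2)) with hK'
        have h1 : K = R * K' := by
          apply toEuclideanLin.injective
          ext1 x
          rw [← hK, List.map_cons, List.prod_cons, LinearIsometryEquiv.coe_mul, Function.comp_apply,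
            toEuclideanLin_reflection v _ hv]
          have : (l.map fun v => (ℝ ∙ v)ᗮ.reflection).prod x = toEuclideanLin K' x := by
            rw [hK', LinearEquiv.apply_symm_apply]; rfl
          rw [this]
          apply WithLp.ofLp_injective 2
          simp [hR, mulVec_mulVec]
        have h2 : K.map Complex.ofReal = R.map Complex.ofReal * K'.map Complex.ofReal := by
          rw [h1]; exact Matrix.map_mul (f := Complex.ofRealHom)
        rw [h2, magic_mul_mul_magic_mul]
        refine mul_mem_localSwapGates (magic_mul_reflection_mul _ ?_) (ih K' fun x => ?_)
        · have : ‖v‖ ≠ 0 := norm_ne_zero_iff.2 hv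
          rw [← EuclideanSpace.real_norm_sq_eq, norm_smul, norm_inv, norm_norm,
            inv_mul_cancel₀ this, one_pow]
        · rw [hK', LinearEquiv.apply_symm_apply]; rfl
  have hiso : ∀ x y : EuclideanSpace ℝ (Fin 2 × Fin 2),
      inner ℝ (toEuclideanLin O x) (toEuclideanLin O y) = inner ℝ x y := by
    intro x y
    simp only [EuclideanSpace.inner_eq_star_dotProduct, star_trivial]
    simp only [ofLp_toLpLin, toLin'_apply]
    rw [dotProduct_mulVec, ← mulVec_transpose, mulVec_mulVec, mul_eq_one_comm.1 hO, one_mulVec]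
  obtain ⟨l, -, hl⟩ :=
    (((toEuclideanLin O).isometryOfInner hiso).toLinearIsometryEquiv rfl).reflections_generate_dim
  exact key l O fun x => by rw [← hl]; rfl

/-! ### The local invariant and local equivalence -/

noncomputable section

/-- The characteristic polynomial of `U J Uᵀ J` with `J = σ_Y ⊗ σ_Y`. In the magic basis `J` is
the identity up to sign, so that this is the characteristic polynomial of `Uᵀ U`. -/
def localInvariant (U : Gate) : ℂ[X] :=
  (U * (pauliY ⊗ₖ pauliY) * Uᵀ * (pauliY ⊗ₖ pauliY)).charpoly

/-- The phases `λ` of the canonical gate, whose eigenvalues are `exp (i λ)`, indexed by the vectors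
of the magic basis. -/
def phase (x y z : ℝ) (p : Fin 2 × Fin 2) : ℝ :=
  (!![x - y + z, x + y - z; -x - y - z, -x + y + z] : Matrix (Fin 2) (Fin 2) ℝ) p.1 p.2

end

theorem pauliY_mul_pauliY : pauliY * pauliY = 1 := by
  ext i j; fin_cases i <;> fin_cases j <;> simp [pauliY, mul_apply, Fin.sum_univ_two]

theorem pauliY_kronecker_mul_self :
    (pauliY ⊗ₖ pauliY) * (pauliY ⊗ₖ pauliY) = (1 : Gate) := by
  rw [← mul_kronecker_mul, pauliY_mul_pauliY, one_kronecker_one]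

theorem mul_pauliY_mul_transpose (A : Matrix (Fin 2) (Fin 2) ℂ) :
    A * pauliY * Aᵀ = A.det • pauliY := by
  ext i j
  fin_cases i <;> fin_cases j <;>
  simp [pauliY, mul_apply, Fin.sum_univ_two, det_fin_two] <;> ring

/-- Local gates preserve the bilinear form `J = σ_Y ⊗ σ_Y`. -/
theorem mul_pauliY_kronecker_mul_transpose {A : Gate} (hA : A ∈ localGates) :
    A * (pauliY ⊗ₖ pauliY) * Aᵀ = pauliY ⊗ₖ pauliY := by
  obtain ⟨A₁, h1, A₂, h2, rfl⟩ := hA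
  rw [← kroneckerMap_transpose, ← mul_kronecker_mul, ← mul_kronecker_mul, mul_pauliY_mul_transpose,
    mul_pauliY_mul_transpose, (mem_specialUnitaryGroup_iff.1 h1).2,
    (mem_specialUnitaryGroup_iff.1 h2).2, one_smul]

theorem transpose_mem_localGates {A : Gate} (hA : A ∈ localGates) : Aᵀ ∈ localGates := by
  obtain ⟨A₁, h1, A₂, h2, rfl⟩ := hA
  have h : ∀ {B : Matrix (Fin 2) (Fin 2) ℂ}, B ∈ specialUnitaryGroup (Fin 2) ℂ →
      Bᵀ ∈ specialUnitaryGroup (Fin 2) ℂ := fun {B} hB => by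
    rw [mem_specialUnitaryGroup_iff] at hB ⊢
    refine ⟨?_, by rw [det_transpose, hB.2]⟩
    rw [mem_unitaryGroup_iff', star_eq_conjTranspose,
      conjTranspose_transpose_eq_transpose_conjTranspose, ← transpose_mul,
      ← star_eq_conjTranspose, mem_unitaryGroup_iff.1 hB.1, transpose_one]
  exact ⟨_, h h1, _, h h2, kroneckerMap_transpose _ _ _ |>.symm⟩

theorem localInvariant_mul_mul {A B : Gate} (hA : A ∈ localGates) (hB : B ∈ localGates) (U : Gate) :
    localInvariant (A * U * B) = localInvariant U := by
  have h1 := mul_pauliY_kronecker_mul_transpose hB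
  have h2 := mul_pauliY_kronecker_mul_transpose (transpose_mem_localGates hA)
  rw [transpose_transpose] at h2
  have h3 : A * U * B * (pauliY ⊗ₖ pauliY) * (A * U * B)ᵀ * (pauliY ⊗ₖ pauliY) =
      A * (U * (B * (pauliY ⊗ₖ pauliY) * Bᵀ) * Uᵀ * (Aᵀ * (pauliY ⊗ₖ pauliY))) := by
    simp only [transpose_mul, Matrix.mul_assoc]
  rw [localInvariant, h3, charpoly_mul_comm, h1, Matrix.mul_assoc _ (Aᵀ * _) A, h2, localInvariant]

theorem sum_phase (x y z : ℝ) : ∑ p, phase x y z p = 0 := by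
  simp [phase, Fintype.sum_prod_type, Fin.sum_univ_two]

/-- The canonical gate is diagonal in the magic basis. -/
theorem canonicalGate_eq (x y z : ℝ) : canonicalGate x y z =
    magic * diagonal (fun p => Complex.exp (phase x y z p * Complex.I)) * magicᴴ := by
  have hinv : magic⁻¹ = magicᴴ := inv_eq_right_inv magic_mul_conjTranspose
  have hH : Complex.I • ((x : ℂ) • (pauliX ⊗ₖ pauliX) + (y : ℂ) • (pauliY ⊗ₖ pauliY)
      + (z : ℂ) • (pauliZ ⊗ₖ pauliZ)) =
      magic * diagonal (fun p => phase x y z p * Complex.I) * magicᴴ := by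
    have : (Complex.I • ((x : ℂ) • (pauliX ⊗ₖ pauliX) + (y : ℂ) • (pauliY ⊗ₖ pauliY)
      + (z : ℂ) • (pauliZ ⊗ₖ pauliZ))) * magic =
      magic * diagonal (fun p => phase x y z p * Complex.I) := by
      ext ⟨a, b⟩ ⟨c, d⟩
      rw [mul_diagonal]
      fin_cases a <;> fin_cases b <;> fin_cases c <;> fin_cases d <;>
      simp [magic, mul_apply, Fintype.sum_prod_type, Fin.sum_univ_two, pauliX, pauliY, pauliZ,
        phase] <;> ring
    rw [← this, Matrix.mul_assoc, magic_mul_conjTranspose, Matrix.mul_one]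
  rw [canonicalGate, hH, ← hinv, Matrix.exp_conj _ _
    ((isUnit_iff_isUnit_det _).2 (isUnit_det_of_right_inverse magic_mul_conjTranspose)),
    Matrix.exp_diagonal]
  congr 3
  ext p
  rw [Pi.coe_exp, Complex.exp_eq_exp_ℂ]

theorem det_canonicalGate (x y z : ℝ) : (canonicalGate x y z).det = 1 := by
  rw [canonicalGate_eq, det_mul_right_comm, magic_mul_conjTranspose, Matrix.one_mul, det_diagonal,
    ← Complex.exp_sum, ← Finset.sum_mul, ← Complex.ofReal_sum, sum_phase]
  simp

theorem swapGate_mul_canonicalGate (x y z : ℝ) :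
    swapGate * canonicalGate x y z = canonicalGate x y z * swapGate := by
  refine Commute.exp_right ?_
  rw [commute_iff_eq]
  simp only [Matrix.mul_smul, Matrix.smul_mul, Matrix.mul_add, Matrix.add_mul,
    swapGate_mul_kronecker]

theorem conj_pauliY_kronecker : (pauliY ⊗ₖ pauliY).map star = pauliY ⊗ₖ pauliY := by
  ext ⟨a, b⟩ ⟨c, d⟩
  fin_cases a <;> fin_cases b <;> fin_cases c <;> fin_cases d <;> simp [pauliY]

theorem magic_conjTranspose_transpose_mul :
    (magicᴴ)ᵀ * magicᴴ = -(pauliY ⊗ₖ pauliY) := by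
  have h := congrArg (fun A : Gate => A.map (starRingEnd ℂ)) magic_mul_transpose
  simp only [Matrix.map_mul] at h
  have h2 : (-(pauliY ⊗ₖ pauliY)).map (starRingEnd ℂ) = -(pauliY ⊗ₖ pauliY) := by
    conv_rhs => rw [← conj_pauliY_kronecker]
    ext i j; simp
  rw [h2] at h
  exact h

theorem localInvariant_eq_charpoly_magic (U : Gate) :
    localInvariant U = ((magicᴴ * U * magic)ᵀ * (magicᴴ * U * magic)).charpoly := by
  have h : (magicᴴ * U * magic)ᵀ * (magicᴴ * U * magic) =
      magicᵀ * (Uᵀ * ((magicᴴ)ᵀ * magicᴴ) * U * magic) := by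
    simp only [transpose_mul, Matrix.mul_assoc]
  rw [h, charpoly_mul_comm, Matrix.mul_assoc, magic_mul_transpose,
    magic_conjTranspose_transpose_mul, localInvariant]
  simp only [Matrix.mul_neg, Matrix.neg_mul, neg_neg]
  rw [Matrix.mul_assoc U, Matrix.mul_assoc U, charpoly_mul_comm]
  simp only [Matrix.mul_assoc]
  rw [charpoly_mul_comm]
  simp only [Matrix.mul_assoc]

theorem localInvariant_canonicalGate (x y z : ℝ) : localInvariant (canonicalGate x y z) =
    ∏ p, (X - C (Complex.exp (phase x y z p * Complex.I) ^ 2)) := by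
  have h : magicᴴ * canonicalGate x y z * magic =
      diagonal (fun p => Complex.exp (phase x y z p * Complex.I)) := by
    rw [canonicalGate_eq]
    calc _ = (magicᴴ * magic) * diagonal (fun p => Complex.exp (phase x y z p * Complex.I)) *
          (magicᴴ * magic) := by simp only [Matrix.mul_assoc]
      _ = _ := by rw [magic_conjTranspose_mul, Matrix.one_mul, Matrix.mul_one]
  rw [localInvariant_eq_charpoly_magic, h, diagonal_transpose, diagonal_mul_diagonal,
    charpoly_diagonal]
  simp only [sq]

/-- A gate with the local invariant of a canonical gate is locally equivalent to it. In the magic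
basis `U = K D O` with `K` and `O` real orthogonal and `D` the diagonal form of the canonical
gate. -/
theorem exists_local_of_localInvariant_eq {U : Gate} (hU : U ∈ unitaryGroup (Fin 2 × Fin 2) ℂ)
    (hdet : U.det = 1) {x y z : ℝ} (h : localInvariant U = localInvariant (canonicalGate x y z)) :
    ∃ A ∈ localGates, ∃ B ∈ localGates, U = A * canonicalGate x y z * B := by
  have hm : magic ∈ unitaryGroup (Fin 2 × Fin 2) ℂ := mem_unitaryGroup_iff.2 magic_mul_conjTranspose
  rw [localInvariant_eq_charpoly_magic, localInvariant_canonicalGate] at h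
  obtain ⟨K, hK, O, hO, hV⟩ := exists_orthogonal_mul_diagonal_mul_orthogonal
    (U := magicᴴ * U * magic) (mul_mem (mul_mem (Unitary.star_mem hm) hU) hm)
    (μ := fun p => Complex.exp (phase x y z p * Complex.I)) (fun p => by
      rw [Complex.star_def, ← Complex.exp_conj, ← Complex.exp_add]
      simp) h
  have hU' : U = (magic * K.map Complex.ofReal * magicᴴ) * canonicalGate x y z *
      (magic * O.map Complex.ofReal * magicᴴ) := by
    rw [canonicalGate_eq, ← magic_mul_mul_magic_mul, ← magic_mul_mul_magic_mul, ← hV]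
    calc U = 1 * U * 1 := by rw [Matrix.one_mul, Matrix.mul_one]
      _ = _ := by rw [← magic_mul_conjTranspose]; simp only [Matrix.mul_assoc]
  have hA := magic_mul_orthogonal_mul hK
  have hB := magic_mul_orthogonal_mul hO
  generalize magic * K.map Complex.ofReal * magicᴴ = A at *
  generalize magic * O.map Complex.ofReal * magicᴴ = B at *
  -- the exchange of the qubits commutes with the canonical gate, and the determinant shows that it
  -- occurs on both sides or on neither
  rw [hU', det_mul, det_mul, det_canonicalGate] at hdet
  rcases hA with hA | ⟨A, hA, rfl⟩ <;> rcases hB with hB | ⟨B, hB, rfl⟩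
  · exact ⟨A, hA, B, hB, hU'⟩
  · rw [det_mul, det_of_mem_localGates hA, det_of_mem_localGates hB, det_swapGate] at hdet
    norm_num at hdet
  · rw [det_mul, det_of_mem_localGates hA, det_of_mem_localGates hB, det_swapGate] at hdet
    norm_num at hdet
  · obtain ⟨B₁, h1, B₂, h2, rfl⟩ := hB
    refine ⟨A, hA, _, ⟨B₂, h2, B₁, h1, rfl⟩, ?_⟩
    rw [hU', ← swapGate_mul_kronecker]
    calc A * swapGate * canonicalGate x y z * (swapGate * (B₂ ⊗ₖ B₁))
        = A * (swapGate * canonicalGate x y z) * swapGate * (B₂ ⊗ₖ B₁) := by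
          simp only [Matrix.mul_assoc]
      _ = A * canonicalGate x y z * (swapGate * swapGate) * (B₂ ⊗ₖ B₁) := by
          rw [swapGate_mul_canonicalGate]; simp only [Matrix.mul_assoc]
      _ = _ := by rw [swapGate_mul_swapGate, Matrix.mul_one]

/-! ### Circuits with two SQiSW gates -/

noncomputable section

/-- The gate iSWAP, the square of SQiSW. -/
def iSWAP : Gate :=
  Matrix.reindex finProdFinEquiv.symm finProdFinEquiv.symm
    !![1, 0, 0, 0; 0, 0, Complex.I, 0; 0, Complex.I, 0, 0; 0, 0, 0, 1]

/-- The inverse of iSWAP. -/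
def iSWAPInv : Gate :=
  Matrix.reindex finProdFinEquiv.symm finProdFinEquiv.symm
    !![1, 0, 0, 0; 0, 0, -Complex.I, 0; 0, -Complex.I, 0, 0; 0, 0, 0, 1]

end

theorem reindex_mul (A B : Matrix (Fin 4) (Fin 4) ℂ) :
    Matrix.reindex finProdFinEquiv.symm finProdFinEquiv.symm (A * B) =
      (Matrix.reindex finProdFinEquiv.symm finProdFinEquiv.symm A *
        Matrix.reindex finProdFinEquiv.symm finProdFinEquiv.symm B : Gate) := by
  simp [reindex_apply, submatrix_mul_equiv]

theorem SQiSW_mul_SQiSW : SQiSW * SQiSW = iSWAP := by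
  have h := inv_sqrt_two_mul_self
  rw [SQiSW, ← reindex_mul, iSWAP]
  congr 1
  ext i j
  fin_cases i <;> fin_cases j <;> simp [mul_apply, Fin.sum_univ_succ] <;> ring_nf <;>
  rw [← sq] at h <;> simp [h]
  ring

theorem iSWAP_mul_iSWAPInv : iSWAP * iSWAPInv = 1 := by
  rw [iSWAP, iSWAPInv, ← reindex_mul]
  have : !![1, 0, 0, 0; 0, 0, Complex.I, 0; 0, Complex.I, 0, 0; 0, 0, 0, 1] *
      !![1, 0, 0, 0; 0, 0, -Complex.I, 0; 0, -Complex.I, 0, 0; 0, 0, 0, 1] =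
      (1 : Matrix (Fin 4) (Fin 4) ℂ) := by
    ext i j
    fin_cases i <;> fin_cases j <;> simp [mul_apply, Fin.sum_univ_succ]
  rw [this]; simp

theorem pauliY_kronecker_eq : (pauliY ⊗ₖ pauliY) =
    Matrix.reindex finProdFinEquiv.symm finProdFinEquiv.symm
      !![0, 0, 0, -1; 0, 0, 1, 0; 0, 1, 0, 0; -1, 0, 0, (0 : ℂ)] := by
  rw [← Equiv.symm_apply_eq, reindex_symm, Equiv.symm_symm, reindex_apply]
  ext i j
  fin_cases i <;> fin_cases j <;> simp [pauliY, finProdFinEquiv, Fin.divNat, Fin.modNat]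

theorem SQiSW_mul_pauliY : SQiSW * (pauliY ⊗ₖ pauliY) = (pauliY ⊗ₖ pauliY) * SQiSW := by
  rw [pauliY_kronecker_eq, SQiSW, ← reindex_mul, ← reindex_mul]
  congr 1
  ext i j
  fin_cases i <;> fin_cases j <;> simp [mul_apply, Fin.sum_univ_succ]

theorem transpose_SQiSW : SQiSWᵀ = SQiSW := by
  rw [SQiSW, transpose_reindex]
  congr 1
  ext i j
  fin_cases i <;> fin_cases j <;> simp

theorem SQiSW_mul_conjTranspose : SQiSW * SQiSWᴴ = 1 := by
  have h := inv_sqrt_two_mul_self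
  rw [SQiSW, conjTranspose_reindex, ← reindex_mul]
  have : !![1, 0, 0, 0; 0, 1 / (Real.sqrt 2 : ℂ), Complex.I / (Real.sqrt 2 : ℂ), 0;
       0, Complex.I / (Real.sqrt 2 : ℂ), 1 / (Real.sqrt 2 : ℂ), 0; 0, 0, 0, 1] *
      !![1, 0, 0, 0; 0, 1 / (Real.sqrt 2 : ℂ), Complex.I / (Real.sqrt 2 : ℂ), 0;
       0, Complex.I / (Real.sqrt 2 : ℂ), 1 / (Real.sqrt 2 : ℂ), 0; 0, 0, 0, 1]ᴴ =
      (1 : Matrix (Fin 4) (Fin 4) ℂ) := by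
    ext i j
    fin_cases i <;> fin_cases j <;> simp [mul_apply, Fin.sum_univ_succ] <;> ring_nf <;>
    rw [← sq] at h <;> simp [h] <;> norm_num
  rw [this]; simp

theorem det_SQiSW : SQiSW.det = 1 := by
  have h := inv_sqrt_two_mul_self
  rw [← sq] at h
  rw [SQiSW, det_reindex_self]
  simp [det_succ_row_zero, Fin.sum_univ_succ, Fin.succAbove]
  ring_nf
  simp [h]
  norm_num

/-- The local invariant of a circuit with two SQiSW gates, as a determinant of low degree in the
single-qubit gates between them. -/
theorem eval_localInvariant_SQiSW_mul {B : Gate} (hB : B ∈ localGates) (μ : ℂ) :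
    (localInvariant (SQiSW * B * SQiSW)).eval μ = (μ • (iSWAPInv * B) - B * iSWAP).det := by
  have h1 := mul_pauliY_kronecker_mul_transpose (transpose_mem_localGates hB)
  rw [transpose_transpose] at h1
  have h2 := iSWAP_mul_iSWAPInv
  have h3 := pauliY_kronecker_mul_self
  have h4 := SQiSW_mul_pauliY
  have h5 := SQiSW_mul_SQiSW
  have h6 : iSWAP.det = 1 := by rw [← h5, det_mul, det_SQiSW, one_mul]
  have h7 : (iSWAPInv * B).det = 1 := by
    have := congrArg det h2
    rw [det_mul, h6, det_one, one_mul] at this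
    rw [det_mul, this, det_of_mem_localGates hB, one_mul]
  rw [localInvariant]
  set J : Gate := pauliY ⊗ₖ pauliY
  have h8 : SQiSW * B * SQiSW * J * (SQiSW * B * SQiSW)ᵀ * J =
      SQiSW * (B * (iSWAP * J * Bᵀ * J) * SQiSW) := by
    simp only [transpose_mul, transpose_SQiSW]
    calc _ = SQiSW * B * SQiSW * (J * SQiSW) * Bᵀ * (SQiSW * J) := by
          simp only [Matrix.mul_assoc]
      _ = SQiSW * B * SQiSW * (SQiSW * J) * Bᵀ * (J * SQiSW) := by rw [h4]
      _ = _ := by rw [← h5]; simp only [Matrix.mul_assoc]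
  -- right multiplication by the unimodular matrix `iSWAP⁻¹ B` cancels the inverse of `B`
  rw [h8, charpoly_mul_comm, eval_charpoly, Matrix.mul_assoc, h5, ← mul_one (det _), ← h7,
    ← det_mul]
  congr 1
  rw [Matrix.sub_mul, scalar_apply, ← smul_one_eq_diagonal, Matrix.smul_mul, Matrix.one_mul]
  congr 1
  calc B * (iSWAP * J * Bᵀ * J) * iSWAP * (iSWAPInv * B)
      = B * (iSWAP * J * Bᵀ * J) * (iSWAP * iSWAPInv) * B := by simp only [Matrix.mul_assoc]
    _ = B * iSWAP * J * (Bᵀ * J * B) := by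
      rw [h2, Matrix.mul_one]; simp only [Matrix.mul_assoc]
    _ = B * iSWAP := by rw [h1, Matrix.mul_assoc, h3, Matrix.mul_one]

theorem det_fin_four_of {R : Type*} [CommRing R] (a b c d e f g h i j k l m n o p : R) :
    !![a, b, c, d; e, f, g, h; i, j, k, l; m, n, o, p].det =
      (a * f - b * e) * (k * p - l * o) - (a * g - c * e) * (j * p - l * n)
      + (a * h - d * e) * (j * o - k * n) + (b * g - c * f) * (i * p - l * m)
      - (b * h - d * f) * (i * o - k * m) + (c * h - d * g) * (i * n - j * m) := by
  simp [det_succ_row_zero, Fin.sum_univ_succ, Fin.succAbove]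
  ring

-- the degree-eight polynomial identity at the end exceeds the default limits
set_option maxRecDepth 100000 in
set_option maxHeartbeats 2000000 in
/-- The determinant of `eval_localInvariant_SQiSW_mul` for arbitrary, not necessarily unitary,
single-qubit matrices; `n` is the product of their determinants, and `t / n` and `t' / n` are the
traces of `T B T B⁻¹` and of its inverse for `T` the gate iSWAP. -/
theorem det_smul_iSWAPInv_mul_sub (p q p' q' r s r' s' μ t t' n : ℂ)
    (ht : t = 2 * p * p' * r * r' + 2 * q * q' * s * s'
      - ((q * s') ^ 2 + (q' * s) ^ 2 + (p * r') ^ 2 + (p' * r) ^ 2)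
      - 2 * Complex.I * (p * s * q' * r' + q * r * p' * s' + q' * r * p' * s + p * s' * q * r'))
    (ht' : t' = 2 * p * p' * r * r' + 2 * q * q' * s * s'
      - ((q * s') ^ 2 + (q' * s) ^ 2 + (p * r') ^ 2 + (p' * r) ^ 2)
      + 2 * Complex.I * (p * s * q' * r' + q * r * p' * s' + q' * r * p' * s + p * s' * q * r'))
    (hn : n = (p * p' - q * q') * (r * r' - s * s')) :
    (μ • (iSWAPInv * (!![p, q; q', p'] ⊗ₖ !![r, s; s', r'])) -
      (!![p, q; q', p'] ⊗ₖ !![r, s; s', r']) * iSWAP).det =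
    n ^ 2 * (μ ^ 4 + 1) - n * t * μ ^ 3 + (4 * (q * q' * r * r' - p * p' * s * s') ^ 2 - 2 * n ^ 2
      + n * (t + t')) * μ ^ 2 - n * t' * μ := by
  have hk : (!![p, q; q', p'] ⊗ₖ !![r, s; s', r'] : Gate) =
      Matrix.reindex finProdFinEquiv.symm finProdFinEquiv.symm
      !![p * r, p * s, q * r, q * s; p * s', p * r', q * s', q * r';
        q' * r, q' * s, p' * r, p' * s; q' * s', q' * r', p' * s', p' * r'] := by
    rw [← Equiv.symm_apply_eq, reindex_symm, Equiv.symm_symm, reindex_apply]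
    ext i j
    fin_cases i <;> fin_cases j <;> simp [finProdFinEquiv, Fin.divNat, Fin.modNat]
  set i := Complex.I with hi
  have hD : μ • (iSWAPInv * (!![p, q; q', p'] ⊗ₖ !![r, s; s', r'])) -
      (!![p, q; q', p'] ⊗ₖ !![r, s; s', r']) * iSWAP =
      Matrix.reindex finProdFinEquiv.symm finProdFinEquiv.symm
      !![(μ - 1) * (p * r), μ * (p * s) - i * (q * r), μ * (q * r) - i * (p * s),
          (μ - 1) * (q * s);
        -(i * μ * (q' * r)) - p * s', -(i * μ * (q' * s)) - i * (q * s'),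
          -(i * μ * (p' * r)) - i * (p * r'), -(i * μ * (p' * s)) - q * r';
        -(i * μ * (p * s')) - q' * r, -(i * μ * (p * r')) - i * (p' * r),
          -(i * μ * (q * s')) - i * (q' * s), -(i * μ * (q * r')) - p' * s;
        (μ - 1) * (q' * s'), μ * (q' * r') - i * (p' * s'), μ * (p' * s') - i * (q' * r'),
          (μ - 1) * (p' * r')] := by
    rw [hk, iSWAPInv, iSWAP, ← reindex_mul, ← reindex_mul]
    rw [← Equiv.symm_apply_eq]
    ext a b
    fin_cases a <;> fin_cases b <;>
    simp [reindex_apply, finProdFinEquiv, Fin.divNat, Fin.modNat,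
      ← hi] <;> ring
  rw [hD, det_reindex_self, ht, ht', hn]
  clear hD hk ht ht' hn
  have h2 : i ^ 2 = -1 := Complex.I_sq
  have h3 : i ^ 3 = -i := by rw [pow_succ, h2]; ring
  have h4 : i ^ 4 = 1 := Complex.I_pow_four
  clear_value i
  rw [← sub_eq_zero]
  rw [det_fin_four_of]
  ring_nf
  simp only [h2, h3, h4]
  ring

/-! ### Trigonometry of the Weyl chamber -/

theorem four_mul_prod_sin_phase (x y z : ℝ) : 4 * ∏ p, Real.sin (phase x y z p) =
    Real.cos (2 * x) ^ 2 + Real.cos (2 * y) ^ 2 + Real.cos (2 * z) ^ 2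
      - 2 * Real.cos (2 * x) * Real.cos (2 * y) * Real.cos (2 * z) - 1 := by
  have h1 : 2 * Real.sin (x - y + z) * Real.sin (x + y - z) =
      Real.cos (2 * y - 2 * z) - Real.cos (2 * x) := by
    rw [Real.two_mul_sin_mul_sin]; congr 1
    · rw [← Real.cos_neg]; congr 1; ring
    · congr 1; ring
  have h2 : 2 * Real.sin (-x - y - z) * Real.sin (-x + y + z) =
      Real.cos (2 * y + 2 * z) - Real.cos (2 * x) := by
    rw [Real.two_mul_sin_mul_sin]; congr 1
    · rw [← Real.cos_neg]; congr 1; ring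
    · rw [← Real.cos_neg]; congr 1; ring
  have h3 : 4 * ∏ p, Real.sin (phase x y z p) =
      (2 * Real.sin (x - y + z) * Real.sin (x + y - z)) *
        (2 * Real.sin (-x - y - z) * Real.sin (-x + y + z)) := by
    simp [phase, Fintype.prod_prod_type, Fin.prod_univ_two]; ring
  rw [h3, h1, h2, Real.cos_sub, Real.cos_add]
  linear_combination (-Real.sin (2 * z) ^ 2) * Real.sin_sq_add_cos_sq (2 * y)
    - (1 - Real.cos (2 * y) ^ 2) * Real.sin_sq_add_cos_sq (2 * z)

/-- The characteristic polynomial of the squared canonical gate, with coefficients in terms of the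
cosines and sines of `2x, 2y, 2z`. -/
theorem eval_localInvariant_canonicalGate (x y z : ℝ) (μ : ℂ) {a b c σ : ℝ}
    (ha : a = Real.cos (2 * x)) (hb : b = Real.cos (2 * y)) (hc : c = Real.cos (2 * z))
    (hσ : σ = Real.sin (2 * x) * Real.sin (2 * y) * Real.sin (2 * z)) :
    (localInvariant (canonicalGate x y z)).eval μ =
      μ ^ 4 + 1 - (4 * a * b * c + 4 * Complex.I * σ) * μ ^ 3
        + (4 * (a ^ 2 + b ^ 2 + c ^ 2) - 6) * μ ^ 2 - (4 * a * b * c - 4 * Complex.I * σ) * μ := by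
  have hcos : ∀ t : ℝ, (Real.cos (2 * t) : ℂ) =
      (Complex.exp (t * Complex.I) ^ 2 + (Complex.exp (t * Complex.I) ^ 2)⁻¹) / 2 := fun t => by
    rw [← Complex.exp_nat_mul, ← Complex.exp_neg, Complex.ofReal_cos, Complex.cos]
    push_cast; ring_nf
  have hsin : ∀ t : ℝ, (Real.sin (2 * t) : ℂ) = -Complex.I *
      (Complex.exp (t * Complex.I) ^ 2 - (Complex.exp (t * Complex.I) ^ 2)⁻¹) / 2 := fun t => by
    rw [← Complex.exp_nat_mul, ← Complex.exp_neg, Complex.ofReal_sin, Complex.sin]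
    push_cast; ring_nf
  rw [localInvariant_canonicalGate, eval_prod, ha, hb, hc, hσ]
  simp only [Complex.ofReal_mul, hcos, hsin]
  have e : ∀ u v w : ℝ, Complex.exp ((u + v + w : ℝ) * Complex.I) =
      Complex.exp (u * Complex.I) * Complex.exp (v * Complex.I) * Complex.exp (w * Complex.I) :=
    fun u v w => by rw [← Complex.exp_add, ← Complex.exp_add]; push_cast; ring_nf
  have en : ∀ u : ℝ, Complex.exp ((-u : ℝ) * Complex.I) = (Complex.exp (u * Complex.I))⁻¹ :=
    fun u => by rw [← Complex.exp_neg]; push_cast; ring_nf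
  simp [phase, Fintype.prod_prod_type, Fin.prod_univ_two, -Complex.ofReal_add,
    -Complex.ofReal_neg, -Complex.ofReal_sub, sub_eq_add_neg, e, en]
  have hx := Complex.exp_ne_zero (x * Complex.I)
  have hy := Complex.exp_ne_zero (y * Complex.I)
  have hz := Complex.exp_ne_zero (z * Complex.I)
  generalize Complex.exp (x * Complex.I) = X at *
  generalize Complex.exp (y * Complex.I) = Y at *
  generalize Complex.exp (z * Complex.I) = Z at *
  field_simp
  ring_nf
  simp only [Complex.I_pow_four]
  ring

/-- In the Weyl chamber the only factor of the product that can have the wrong sign is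
`sin (x - y - |z|)`. -/
theorem le_of_prod_sin_phase_nonneg {x y z : ℝ} (h : (x, y, z) ∈ weylChamber)
    (hs : 0 ≤ ∏ p, Real.sin (phase x y z p)) : y + |z| ≤ x := by
  obtain ⟨h1, h2, h3, -⟩ := h
  have hpi := Real.pi_pos
  by_contra! hlt
  simp [phase, Fintype.prod_prod_type, Fin.prod_univ_two] at hs
  have hz := abs_nonneg z
  have hz1 := le_abs_self z
  have hz2 := neg_abs_le z
  have p2 : 0 < Real.sin (x + y - z) := Real.sin_pos_of_pos_of_lt_pi (by linarith) (by linarith)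
  have p3 : 0 < Real.sin (x + y + z) := Real.sin_pos_of_pos_of_lt_pi (by linarith) (by linarith)
  have e3 : Real.sin (-x - y - z) = -Real.sin (x + y + z) := by
    rw [← Real.sin_neg]; congr 1; ring
  rw [e3] at hs
  have hprod : 0 < Real.sin (x - y + z) * Real.sin (-x + y + z) := by
    rcases le_total 0 z with h0 | h0
    · rw [abs_of_nonneg h0] at *
      exact mul_pos (Real.sin_pos_of_pos_of_lt_pi (by linarith) (by linarith))
        (Real.sin_pos_of_pos_of_lt_pi (by linarith) (by linarith))
    · rw [abs_of_nonpos h0] at *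
      exact mul_pos_of_neg_of_neg (Real.sin_neg_of_neg_of_neg_pi_lt (by linarith) (by linarith))
        (Real.sin_neg_of_neg_of_neg_pi_lt (by linarith) (by linarith))
  nlinarith [mul_pos hprod (mul_pos p2 p3)]

theorem prod_sin_phase_nonneg {x y z : ℝ} (h : (x, y, z) ∈ regionW') :
    0 ≤ ∏ p, Real.sin (phase x y z p) := by
  obtain ⟨-, h1, h2, h3, h4⟩ := h
  have hpi := Real.pi_pos
  simp [phase, Fintype.prod_prod_type, Fin.prod_univ_two]
  have hz := abs_nonneg z
  have hz1 := le_abs_self z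
  have hz2 := neg_abs_le z
  have p1 := Real.sin_nonneg_of_nonneg_of_le_pi (x := x - y + z) (by linarith) (by linarith)
  have p2 := Real.sin_nonneg_of_nonneg_of_le_pi (x := x + y - z) (by linarith) (by linarith)
  have p3 := Real.sin_nonpos_of_nonpos_of_neg_pi_le (x := -x - y - z) (by linarith) (by linarith)
  have p4 := Real.sin_nonpos_of_nonpos_of_neg_pi_le (x := -x + y + z) (by linarith) (by linarith)
  exact mul_nonneg (mul_nonneg p1 p2) (mul_nonneg_of_nonpos_of_nonpos p3 p4)

/-- The parameters of the single-qubit gates between two SQiSW gates that reach a given point.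
The equations say that the coefficients of the two characteristic polynomials agree. -/
theorem exists_parameters {x y z : ℝ} (h : (x, y, z) ∈ regionW') :
    ∃ p₁ p₂ q r s : ℝ, p₁ ^ 2 + p₂ ^ 2 + q ^ 2 = 1 ∧ r ^ 2 + s ^ 2 = 1 ∧
      r ^ 2 * p₂ ^ 2 = Real.cos (2 * x) * Real.cos (2 * y) * Real.cos (2 * z) ∧
      2 * p₁ * q * r * s = Real.sin (2 * x) * Real.sin (2 * y) * Real.sin (2 * z) ∧
      (q ^ 2 - s ^ 2) ^ 2 = 4 * ∏ p, Real.sin (phase x y z p) := by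
  have hC := prod_sin_phase_nonneg h
  have h4C := four_mul_prod_sin_phase x y z
  set C := ∏ p, Real.sin (phase x y z p)
  obtain ⟨-, h1, h2, h3, h4⟩ := h
  have hpi := Real.pi_pos
  have hz := abs_nonneg z
  have ha0 : 0 ≤ Real.cos (2 * x) := Real.cos_nonneg_of_mem_Icc ⟨by linarith, by linarith⟩
  have hab : Real.cos (2 * x) ≤ Real.cos (2 * y) :=
    Real.cos_le_cos_of_nonneg_of_le_pi (by linarith) (by linarith) (by linarith)
  have hbc : Real.cos (2 * y) ≤ Real.cos (2 * z) := by
    rw [← Real.cos_abs (2 * z), abs_mul, abs_of_pos (zero_lt_two' ℝ)]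
    exact Real.cos_le_cos_of_nonneg_of_le_pi (by linarith) (by linarith) (by linarith)
  have hc1 : Real.cos (2 * z) ≤ 1 := Real.cos_le_one _
  have hsx := Real.sin_sq_add_cos_sq x
  have hsy := Real.sin_sq_add_cos_sq y
  have hsz := Real.sin_sq_add_cos_sq z
  have ea := Real.cos_two_mul x
  have eb := Real.cos_two_mul y
  have ec := Real.cos_two_mul z
  rw [Real.sin_two_mul, Real.sin_two_mul, Real.sin_two_mul]
  set a := Real.cos (2 * x)
  set b := Real.cos (2 * y)
  set c := Real.cos (2 * z)
  have hb0 : 0 ≤ b := ha0.trans hab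
  have hc0 : 0 ≤ c := hb0.trans hbc
  -- `q²` and `s²` are the roots `w ± d` of a quadratic polynomial whose value at `0` is `P` and
  -- whose value at `1` is `R + a b c`; both values are nonnegative and `0 ≤ w ≤ 1 / 2`, which puts
  -- the roots in `[0, 1]`. The choice of `w` makes `4 P R` the square of the product of the three sines.
  set P := (1 - a) * (1 + b) * (1 - c) / 2 with hP
  set R := (1 + a) * (1 - b) * (1 + c) / 2 with hR
  set w := (1 - a + b - c) / 2 with hw
  set d := Real.sqrt C with hd
  have hdd : d ^ 2 = C := Real.sq_sqrt hC
  have hd0 : 0 ≤ d := Real.sqrt_nonneg C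
  have hP0 : 0 ≤ P := by
    have := mul_nonneg (mul_nonneg (sub_nonneg.2 (hab.trans (hbc.trans hc1)))
      (add_nonneg zero_le_one hb0)) (sub_nonneg.2 hc1)
    positivity
  have hR0 : 0 ≤ R := by
    have := mul_nonneg (mul_nonneg (add_nonneg zero_le_one ha0) (sub_nonneg.2 (hbc.trans hc1)))
      (add_nonneg zero_le_one hc0)
    positivity
  have habc : 0 ≤ a * b * c := by positivity
  have hw0 : 0 ≤ w := by rw [hw]; linarith
  have hw1 : w ≤ 1 / 2 := by rw [hw]; linarith
  have e1 : w ^ 2 - d ^ 2 = P := by rw [hdd, hw, hP]; linear_combination -h4C / 4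
  have e2 : (1 - w) ^ 2 - d ^ 2 = R + a * b * c := by
    rw [hdd, hw, hR]; linear_combination -h4C / 4
  have hdw : d ≤ w := abs_le_of_sq_le_sq' (by linarith) hw0 |>.2
  have hdw1 : d ≤ 1 - w := abs_le_of_sq_le_sq' (by linarith) (by linarith) |>.2
  have hr0 : 0 < 1 - (w - d) := by linarith
  have hr : 0 < Real.sqrt (1 - (w - d)) := Real.sqrt_pos.2 hr0
  have hr2 : Real.sqrt (1 - (w - d)) ^ 2 = 1 - (w - d) := Real.sq_sqrt hr0.le
  have hs2 : Real.sqrt (w - d) ^ 2 = w - d := Real.sq_sqrt (by linarith)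
  have hq2 : Real.sqrt (w + d) ^ 2 = w + d := Real.sq_sqrt (by linarith)
  have hp2 : Real.sqrt (a * b * c) ^ 2 = a * b * c := Real.sq_sqrt habc
  -- the sign of `q s` is that of `z`
  obtain ⟨q, hq, hqs⟩ : ∃ q : ℝ, q ^ 2 = w + d ∧
      q * Real.sqrt (w - d) = 2 * Real.sin x * Real.cos y * Real.sin z := by
    have hsq : (Real.sqrt (w + d) * Real.sqrt (w - d)) ^ 2 =
        (2 * Real.sin x * Real.cos y * Real.sin z) ^ 2 := by
      rw [mul_pow, hq2, hs2]
      have : (w + d) * (w - d) = P := by rw [← e1]; ring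
      rw [this, hP, ea, eb, ec]
      have f1 : Real.sin x ^ 2 = 1 - Real.cos x ^ 2 := by linarith
      have f3 : Real.sin z ^ 2 = 1 - Real.cos z ^ 2 := by linarith
      rw [mul_pow, mul_pow, mul_pow, f1, f3]
      ring
    rcases sq_eq_sq_iff_eq_or_eq_neg.1 hsq with h | h
    · exact ⟨_, hq2, h⟩
    · exact ⟨-Real.sqrt (w + d), by rw [neg_sq, hq2], by rw [neg_mul, h, neg_neg]⟩
  set r := Real.sqrt (1 - (w - d))
  set s := Real.sqrt (w - d)
  have hRsq : R = (2 * Real.cos x * Real.sin y * Real.cos z) ^ 2 := by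
    have f2 : Real.sin y ^ 2 = 1 - Real.cos y ^ 2 := by linarith
    rw [hR, mul_pow, mul_pow, mul_pow, f2, ea, eb, ec]
    ring
  refine ⟨2 * Real.cos x * Real.sin y * Real.cos z / r, Real.sqrt (a * b * c) / r, q, r, s,
    ?_, by rw [hr2, hs2]; ring, ?_, ?_, ?_⟩
  · rw [div_pow, div_pow, hp2, ← hRsq, hq, ← add_div, ← e2, hr2]
    field_simp
    ring
  · rw [div_pow, hp2]; field_simp
  · have : 2 * (2 * Real.cos x * Real.sin y * Real.cos z / r) * q * r * s =
        2 * (2 * Real.cos x * Real.sin y * Real.cos z) * (q * s) := by field_simp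
    rw [this, hqs]; ring
  · rw [hq, hs2, ← hdd]; ring

/-! ### The region reached by two SQiSW gates -/

theorem exists_eq_of_mem_specialUnitaryGroup {A : Matrix (Fin 2) (Fin 2) ℂ}
    (hA : A ∈ specialUnitaryGroup (Fin 2) ℂ) :
    ∃ p q : ℂ, p * star p + q * star q = 1 ∧ A = !![p, q; -star q, star p] := by
  obtain ⟨hU, hdet⟩ := mem_specialUnitaryGroup_iff.1 hA
  have h1 := mem_unitaryGroup_iff.1 hU
  have h2 : A⁻¹ = star A := inv_eq_right_inv h1
  rw [inv_def, hdet, Ring.inverse_one, one_smul, adjugate_fin_two] at h2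
  have e1 : A 1 1 = star (A 0 0) := by
    simpa using congrFun (congrFun h2 0) 0
  have e2 : A 1 0 = -star (A 0 1) := by
    have := congrFun (congrFun h2 1) 0
    simp at this
    rw [Complex.star_def, ← this, neg_neg]
  have e3 : A = !![A 0 0, A 0 1; -star (A 0 1), star (A 0 0)] := by
    rw [← e1, ← e2]; exact eta_fin_two A
  refine ⟨A 0 0, A 0 1, ?_, e3⟩
  rw [det_fin_two, e1, e2] at hdet
  linear_combination hdet

/-- For two SQiSW gates the characteristic polynomial defining the local invariant takes
nonnegative real values at `1` and `-1`. With `(p, q)` and `(r, s)` the first rows of the two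
single-qubit gates, the value at `1` is the square of `2 (|q|² - |s|²)`; the value at `-1`
exceeds it by a multiple of a sum of squares of imaginary parts. -/
theorem exists_nonneg_eval_localInvariant {B : Gate} (hB : B ∈ localGates) :
    (∃ v : ℝ, 0 ≤ v ∧ (localInvariant (SQiSW * B * SQiSW)).eval 1 = v) ∧
      ∃ v : ℝ, 0 ≤ v ∧ (localInvariant (SQiSW * B * SQiSW)).eval (-1) = v := by
  rw [eval_localInvariant_SQiSW_mul hB, eval_localInvariant_SQiSW_mul hB]
  obtain ⟨B₁, h1, B₂, h2, rfl⟩ := hB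
  obtain ⟨p, q, hpq, rfl⟩ := exists_eq_of_mem_specialUnitaryGroup h1
  obtain ⟨r, s, hrs, rfl⟩ := exists_eq_of_mem_specialUnitaryGroup h2
  have hn : (1 : ℂ) = (p * star p - q * -star q) * (r * star r - s * -star s) := by
    linear_combination (-1 - (r * star r + s * star s - 1)) * hpq - hrs
  rw [det_smul_iSWAPInv_mul_sub (ht := rfl) (ht' := rfl) (hn := hn),
    det_smul_iSWAPInv_mul_sub (ht := rfl) (ht' := rfl) (hn := hn)]
  clear hn hpq hrs h1 h2
  set u := Complex.normSq p * Complex.normSq s - Complex.normSq q * Complex.normSq r with hu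
  -- half the real part of the trace of `T B T B⁻¹`, where `T` is iSWAP
  set v := 2 * ((q * star s).im ^ 2 + (p * star r).im ^ 2) with hv
  have hpp : p * star p = Complex.normSq p := Complex.mul_conj p
  have hqq : q * star q = Complex.normSq q := Complex.mul_conj q
  have hrr : r * star r = Complex.normSq r := Complex.mul_conj r
  have hss : s * star s = Complex.normSq s := Complex.mul_conj s
  have him : ∀ w : ℂ, ((w.im ^ 2 : ℝ) : ℂ) * 4 = 2 * (w * star w) - w ^ 2 - star w ^ 2 := by
    intro w
    have : w - star w = (2 * w.im : ℝ) * Complex.I := Complex.sub_conj w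
    have h2 : (w - star w) ^ 2 = -4 * ((w.im ^ 2 : ℝ) : ℂ) := by
      rw [this, mul_pow, Complex.I_sq]; push_cast; ring
    linear_combination h2
  have h3 := him (q * star s)
  have h4 := him (p * star r)
  rw [star_mul', star_star] at h3 h4
  refine ⟨⟨4 * u ^ 2, by positivity, ?_⟩, ⟨4 * u ^ 2 + 8 * v, by positivity, ?_⟩⟩
  · rw [hu]; push_cast; rw [← hpp, ← hqq, ← hrr, ← hss]; ring
  · rw [hu, hv]
    push_cast at h3 h4 ⊢
    rw [← hpp, ← hqq, ← hrr, ← hss]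
    linear_combination (-4) * h3 - 4 * h4

theorem eval_one_localInvariant_canonicalGate (x y z : ℝ) :
    (localInvariant (canonicalGate x y z)).eval 1 =
      ((16 * ∏ p, Real.sin (phase x y z p) : ℝ) : ℂ) := by
  have h := four_mul_prod_sin_phase x y z
  have : 16 * ∏ p, Real.sin (phase x y z p) = 4 * (4 * ∏ p, Real.sin (phase x y z p)) := by ring
  rw [this, h, eval_localInvariant_canonicalGate x y z 1 rfl rfl rfl rfl]
  push_cast
  ring

/-- Multiplication by `i` changes the sign of the matrix `U J Uᵀ J`. -/
theorem eval_neg_one_localInvariant_I_smul (U : Gate) :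
    (localInvariant (Complex.I • U)).eval (-1) = (localInvariant U).eval 1 := by
  have h : (Complex.I • U) * (pauliY ⊗ₖ pauliY) * (Complex.I • U)ᵀ * (pauliY ⊗ₖ pauliY) =
      -(U * (pauliY ⊗ₖ pauliY) * Uᵀ * (pauliY ⊗ₖ pauliY)) := by
    rw [transpose_smul]
    simp only [Matrix.smul_mul, Matrix.mul_smul, smul_smul, Complex.I_mul_I, neg_one_smul,
      Matrix.neg_mul]
  rw [localInvariant, localInvariant, eval_charpoly, eval_charpoly, h, map_neg, map_one,
    ← neg_sub, det_neg]
  simp [neg_add_eq_sub]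
  ring

/-- If the phase of the decomposition is `i` then the value at `-1` is used in place of the
value at `1`, so that both cases give the same inequality for the canonical gate. -/
theorem spannedRegion_subset : spannedRegion twoSQiSWGates ⊆ regionW' := by
  rintro ⟨x, y, z⟩ ⟨U, ⟨A, hA, B, hB, C, hC, hU⟩, hW, g, hg, A', hA', B', hB', hU'⟩
  have h1 : localInvariant U = localInvariant (SQiSW * B * SQiSW) := by
    rw [hU, ← localInvariant_mul_mul hA hC (SQiSW * B * SQiSW)]
    congr 1
    simp only [Matrix.mul_assoc]
  have h2 : localInvariant (A' * canonicalGate x y z * B') =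
      localInvariant (canonicalGate x y z) := localInvariant_mul_mul hA' hB' _
  have hs : 0 ≤ ∏ p, Real.sin (phase x y z p) := by
    have h3 := eval_one_localInvariant_canonicalGate x y z
    obtain ⟨⟨v, hv, hv'⟩, ⟨w, hw, hw'⟩⟩ := exists_nonneg_eval_localInvariant hB
    rw [← h1, hU'] at hv' hw'
    rcases hg with rfl | rfl
    · rw [one_smul, h2, h3, Complex.ofReal_inj] at hv'
      linarith
    · rw [eval_neg_one_localInvariant_I_smul, h2, h3, Complex.ofReal_inj] at hw'
      linarith
  exact ⟨hW, hW.1, hW.2.1, hW.2.2.1, le_of_prod_sin_phase_nonneg hW hs⟩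

/-- The local invariants of the circuit with the parameters of `exists_parameters` and of the
canonical gate agree, so the two gates are locally equivalent. -/
theorem regionW'_subset : regionW' ⊆ spannedRegion twoSQiSWGates := by
  rintro ⟨x, y, z⟩ h
  obtain ⟨p₁, p₂, q, r, s, h1, h2, h3, h4, h5⟩ := exists_parameters h
  have hB₁ : !![p₁ + p₂ * Complex.I, (q : ℂ); -star (q : ℂ), star (p₁ + p₂ * Complex.I)] ∈
      specialUnitaryGroup (Fin 2) ℂ := mem_specialUnitaryGroup_of_mul_star (by
    have : ((p₁ ^ 2 + p₂ ^ 2 + q ^ 2 : ℝ) : ℂ) = 1 := by rw [h1]; simp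
    simp
    push_cast at this
    linear_combination this - (p₂ : ℂ) ^ 2 * Complex.I_sq)
  have hB₂ : !![(r : ℂ), (s : ℂ); -star (s : ℂ), star (r : ℂ)] ∈
      specialUnitaryGroup (Fin 2) ℂ := mem_specialUnitaryGroup_of_mul_star (by
    have : ((r ^ 2 + s ^ 2 : ℝ) : ℂ) = 1 := by rw [h2]; simp
    simp
    push_cast at this
    linear_combination this)
  have hB : !![p₁ + p₂ * Complex.I, (q : ℂ); -star (q : ℂ), star (p₁ + p₂ * Complex.I)] ⊗ₖ
      !![(r : ℂ), (s : ℂ); -star (s : ℂ), star (r : ℂ)] ∈ localGates :=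
    ⟨_, hB₁, _, hB₂, rfl⟩
  have hS : SQiSW ∈ unitaryGroup (Fin 2 × Fin 2) ℂ := mem_unitaryGroup_iff.2 SQiSW_mul_conjTranspose
  have hinv := fun μ => eval_localInvariant_SQiSW_mul hB μ
  generalize hBeq : (!![p₁ + p₂ * Complex.I, (q : ℂ); -star (q : ℂ), star (p₁ + p₂ * Complex.I)] ⊗ₖ
      !![(r : ℂ), (s : ℂ); -star (s : ℂ), star (r : ℂ)] : Gate) = B at *
  have hL : localInvariant (SQiSW * B * SQiSW) = localInvariant (canonicalGate x y z) := by
    refine Polynomial.funext fun μ => ?_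
    rw [hinv, eval_localInvariant_canonicalGate x y z μ rfl rfl rfl rfl, ← hBeq,
      det_smul_iSWAPInv_mul_sub
        (t := 4 * (r ^ 2 * p₂ ^ 2 : ℝ) + 4 * Complex.I * (2 * p₁ * q * r * s : ℝ))
        (t' := 4 * (r ^ 2 * p₂ ^ 2 : ℝ) - 4 * Complex.I * (2 * p₁ * q * r * s : ℝ)) (n := 1)]
    · have h6 := h5.trans (four_mul_prod_sin_phase x y z)
      rw [← h4, h3]
      have h7 : (q ^ 2 * r ^ 2 - (p₁ ^ 2 + p₂ ^ 2) * s ^ 2) ^ 2 = Real.cos (2 * x) ^ 2 +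
          Real.cos (2 * y) ^ 2 + Real.cos (2 * z) ^ 2 - 2 * Real.cos (2 * x) * Real.cos (2 * y) *
          Real.cos (2 * z) - 1 := by
        rw [← h6]; congr 1
        linear_combination q ^ 2 * h2 - s ^ 2 * h1
      have h8 := congrArg (fun t : ℝ => (t : ℂ)) h7
      simp [-Complex.ofReal_cos] at h8 ⊢
      linear_combination (4 * μ ^ 2) * h8 + 4 * μ ^ 2 * p₂ ^ 2 * s ^ 2 * (2 * q ^ 2 * r ^ 2
        - (2 * p₁ ^ 2 + p₂ ^ 2 * (1 - Complex.I ^ 2)) * s ^ 2) * Complex.I_sq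
    · simp
      ring_nf
      simp only [Complex.I_sq]
      ring
    · simp
      ring_nf
      simp only [Complex.I_sq]
      ring
    · have h6 : ((p₁ ^ 2 + p₂ ^ 2 + q ^ 2 : ℝ) : ℂ) = 1 := by rw [h1]; simp
      have h7 : ((r ^ 2 + s ^ 2 : ℝ) : ℂ) = 1 := by rw [h2]; simp
      push_cast at h6 h7
      simp
      linear_combination -h6 * (r ^ 2 + s ^ 2) - h7
        + (p₂ : ℂ) ^ 2 * (r ^ 2 + s ^ 2) * Complex.I_sq
  obtain ⟨A', hA', B', hB', hU⟩ := exists_local_of_localInvariant_eq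
    (mul_mem (mul_mem hS (mem_unitaryGroup_of_mem_localGates hB)) hS)
    (by rw [det_mul, det_mul, det_SQiSW, det_of_mem_localGates hB]; simp) hL
  refine ⟨SQiSW * B * SQiSW, ⟨1, one_mem_localGates, B, hB, 1, one_mem_localGates, by simp⟩, h.1,
    1, Or.inl rfl, A', hA', B', hB', ?_⟩
  rw [one_smul, hU]

end TwoQubit

theorem mainTheorem2 :
    TwoQubit.spannedRegion TwoQubit.twoSQiSWGates = TwoQubit.regionW' :=
  TwoQubit.spannedRegion_subset.antisymm TwoQubit.regionW'_subset
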